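/- Let $q$ be a prime power, let $\mathbb{F}$ be a finite field with $q^2$ elements, let $R=\mathbb{F}[X,Y]/\langle Y^q+Y-X^{q+1}\rangle$ be the coordinate ring of the affine Hermitian curve $H$, and let $P_1,\dots,P_n$ (with $n=q^3$) be the distinct $\mathbb{F}$-rational points of $H$. For a rational point $P$ let $\mathfrak{m}_P=\{f\in R\mid f(P)=0\}$, and for $f\in R$ let $v_P(f)$ be the largest integer $r$ such that $f\in\mathfrak{m}_P^r$. For $\gamma\in\mathbb{F}$ let $\mathfrak{m}_{(P,\gamma)}=\{f\in R[z]\mid f(P,\gamma)=0\}$, and for $f\in R[z]$ let $\mathrm{mult}_{(P,\gamma)}(f)$ be the largest integer $r$ such that $f\in\mathfrak{m}_{(P,\gamma)}^r$. (By convention $v_P(0)=\mathrm{mult}_{(P,\gamma)}(0)=\infty$.) For a doubly indexed list $M=[m_{i\gamma}\mid 1\le i\le n,\ \gamma\in\mathbb{F}]$ of nonnegative integers put $$I_M=\{f\in R[z]\mid \mathrm{mult}_{(P_i,\gamma)}(f)\ge m_{i\gamma}\text{ for all }1\le i\le n,\ \gamma\in\mathbb{F}\},$$ and for a list $N=[n_i\mid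 1\le i\le n]$ of nonnegative integers put $$J_N=\{f\in R\mid v_{P_i}(f)\ge n_i\text{ for all }1\le i\le n\}.$$ **Proposition.** Let $M=[m_{i\gamma}]$ be a doubly indexed list of nonnegative integers. For each $i$ let $n_i=\max_{\gamma\in\mathbb{F}}m_{i\gamma}$, and let $N=[n_i]$. For each $i$ with $n_i>0$, let $\gamma_i\in\mathbb{F}$ be such that $m_{i\gamma_i}=n_i$. Let $M'=[m'_{i\gamma}]$, where $m'_{i\gamma_i}=m_{i\gamma_i}-1$ for each $i$ with $n_i>0$, and $m'_{i\gamma}=m_{i\gamma}$ for all other pairs $(i,\gamma)$. Let $h\in R$ be such that $h(P_i)=\gamma_i$ for every $i$ with $n_i>0$. Then, as $R$-submodules of $R[z]$, $$I_M=(z-h)\,I_{M'}+J_N.$$ -/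

import Mathlib

open Polynomial

noncomputable section

namespace Hermitian

/-- The defining polynomial `Y ^ q + Y - X ^ (q + 1)` of the affine Hermitian curve;
the variable `X` is `MvPolynomial.X 0` and the variable `Y` is `MvPolynomial.X 1`. -/
def curvePoly (F : Type*) [Field F] (q : ℕ) : MvPolynomial (Fin 2) F :=
  MvPolynomial.X 1 ^ q + MvPolynomial.X 1 - MvPolynomial.X 0 ^ (q + 1)

/-- The coordinate ring `R = F[X, Y] / (Y ^ q + Y - X ^ (q + 1))` of the affine Hermitian curve. -/
abbrev CoordRing (F : Type*) [Field F] (q : ℕ) : Type _ :=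
  MvPolynomial (Fin 2) F ⧸ Ideal.span {curvePoly F q}

/-- The `F`-rational points `(α, β)` of the affine Hermitian curve. -/
abbrev RatPoint (F : Type*) [Field F] (q : ℕ) : Type _ :=
  {P : F × F // P.2 ^ q + P.2 = P.1 ^ (q + 1)}

variable {F : Type*} [Field F] {q : ℕ}

/-- Evaluation `f ↦ f(P)` of a regular function on the curve at a rational point `P`. -/
def evalAt (P : RatPoint F q) : CoordRing F q →ₐ[F] F :=
  Ideal.Quotient.liftₐ (Ideal.span {curvePoly F q})
    (MvPolynomial.aeval ![P.1.1, P.1.2]) (by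
      intro a ha
      obtain ⟨b, rfl⟩ := Ideal.mem_span_singleton.mp ha
      have h := P.2
      simp [curvePoly, h])

/-- The maximal ideal `𝔪_P = {f ∈ R | f(P) = 0}`. -/
def maxIdeal (P : RatPoint F q) : Ideal (CoordRing F q) :=
  RingHom.ker (evalAt P)

/-- Evaluation `f ↦ f(P, γ)` of a regular function `f ∈ R[z]` on the surface `H × 𝔸¹`. -/
def surfEvalAt (P : RatPoint F q) (γ : F) : (CoordRing F q)[X] →+* F :=
  Polynomial.eval₂RingHom (evalAt P : CoordRing F q →+* F) γ

/-- The maximal ideal `𝔪_S = {f ∈ R[z] | f(S) = 0}` of the point `S = (P, γ)` of `H × 𝔸¹`. -/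
def surfMaxIdeal (P : RatPoint F q) (γ : F) : Ideal (CoordRing F q)[X] :=
  RingHom.ker (surfEvalAt P γ)

/-- The order of `f` along an ideal `I`: the largest `r` with `f ∈ I ^ r`
(and `⊤` if `f` lies in all powers of `I`, as `f = 0` does). -/
def ordAlong {A : Type*} [CommRing A] (I : Ideal A) (f : A) : ℕ∞ :=
  ⨆ (r : ℕ) (_ : f ∈ I ^ r), (r : ℕ∞)

theorem le_ordAlong_iff {A : Type*} [CommRing A] (I : Ideal A) (f : A) (m : ℕ) :
    (m : ℕ∞) ≤ ordAlong I f ↔ f ∈ I ^ m := by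
  constructor
  · intro h
    rcases Nat.eq_zero_or_pos m with rfl | hm
    · simp
    by_contra hf
    have hlt : ordAlong I f ≤ ((m - 1 : ℕ) : ℕ∞) := by
      refine iSup₂_le fun r hr => ?_
      have hrm : r < m := by
        by_contra hge
        exact hf (Ideal.pow_le_pow_right (not_lt.mp hge) hr)
      exact_mod_cast Nat.le_sub_one_of_lt hrm
    have h2 : m ≤ m - 1 := by exact_mod_cast h.trans hlt
    omega
  · intro h
    exact le_iSup₂ (f := fun (r : ℕ) (_ : f ∈ I ^ r) => (r : ℕ∞)) m h

/-- The valuation `v_P(f)`: the largest `r` with `f ∈ 𝔪_P ^ r`. -/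
def val (P : RatPoint F q) (f : CoordRing F q) : ℕ∞ :=
  ordAlong (maxIdeal P) f

/-- The multiplicity of `f ∈ R[z]` at `(P, γ)`: the largest `r` with `f ∈ 𝔪_(P,γ) ^ r`. -/
def mult (P : RatPoint F q) (γ : F) (f : (CoordRing F q)[X]) : ℕ∞ :=
  ordAlong (surfMaxIdeal P γ) f

/-- The interpolation ideal
`I_M = {f ∈ R[z] | mult_(P_i, γ)(f) ≥ m_{iγ} for all i and γ}`. -/
def interpIdeal {n : ℕ} (P : Fin n → RatPoint F q) (M : Fin n → F → ℕ) :
    Ideal (CoordRing F q)[X] where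
  carrier := {f | ∀ i γ, (M i γ : ℕ∞) ≤ mult (P i) γ f}
  zero_mem' := fun _ _ => (le_ordAlong_iff _ _ _).2 (Ideal.zero_mem _)
  add_mem' := fun ha hb i γ => (le_ordAlong_iff _ _ _).2
    (Ideal.add_mem _ ((le_ordAlong_iff _ _ _).1 (ha i γ)) ((le_ordAlong_iff _ _ _).1 (hb i γ)))
  smul_mem' := fun c _ ha i γ => (le_ordAlong_iff _ _ _).2
    (Ideal.mul_mem_left _ c ((le_ordAlong_iff _ _ _).1 (ha i γ)))

/-- The ideal `J_N = {f ∈ R | v_{P_i}(f) ≥ n_i for all i}`. -/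
def valIdeal {n : ℕ} (P : Fin n → RatPoint F q) (N : Fin n → ℕ) :
    Ideal (CoordRing F q) where
  carrier := {f | ∀ i, (N i : ℕ∞) ≤ val (P i) f}
  zero_mem' := fun _ => (le_ordAlong_iff _ _ _).2 (Ideal.zero_mem _)
  add_mem' := fun ha hb i => (le_ordAlong_iff _ _ _).2
    (Ideal.add_mem _ ((le_ordAlong_iff _ _ _).1 (ha i)) ((le_ordAlong_iff _ _ _).1 (hb i)))
  smul_mem' := fun c _ ha i => (le_ordAlong_iff _ _ _).2
    (Ideal.mul_mem_left _ c ((le_ordAlong_iff _ _ _).1 (ha i)))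

/-- The list `N = [n_i]` with `n_i = max_γ m_{iγ}`. -/
def maxMult [Fintype F] {n : ℕ} (M : Fin n → F → ℕ) (i : Fin n) : ℕ :=
  Finset.univ.sup' Finset.univ_nonempty (M i)

open Classical in
/-- The list `M'`: for each `i` with `n_i > 0`, the entry at `(i, γ_i)` is lowered by one;
all other entries are unchanged. -/
def lowered [Fintype F] {n : ℕ} (M : Fin n → F → ℕ) (g : Fin n → F) : Fin n → F → ℕ :=
  fun i γ => if 0 < maxMult M i ∧ γ = g i then M i γ - 1 else M i γ

end Hermitian

end

/-! Dividing `f` by `z - h` leaves the remainder `f(h)`. Substituting `h` for `z` maps powers of the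
ideal of `(P, h(P))` into the same powers of the ideal of `P` (`eval_mem_ker_pow`), so `f(h)` lies
in `J_N`. Since `n_i` bounds every `m_{iγ}`, elements of `J_N` lie in `I_M`, and hence so does `(z -
h) f₁`, where `f₁` is the quotient. What remains is local: multiplication by `z - h` raises the
multiplicity by exactly one at points on the graph of `h`, and leaves it unchanged at the others
(`X_sub_C_mul_mem_interpIdeal_iff`). Smoothness of the curve plays no role. -/

namespace Polynomial

variable {A : Type*} [CommRing A]

/-- Powers of the ideal `{f | f(0) ∈ K}` of `A[X]` are described coefficientwise. -/
theorem mem_comap_constantCoeff_pow_iff (K : Ideal A) (m : ℕ) (f : A[X]) :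
    f ∈ (K.comap (constantCoeff : A[X] →+* A)) ^ m ↔ ∀ j, f.coeff j ∈ K ^ (m - j) := by
  constructor
  · intro hf
    induction m generalizing f with
    | zero => simp
    | succ m ih =>
      rw [pow_succ'] at hf
      induction hf using Submodule.mul_induction_on' with
      | mem_mul_mem a ha b hb =>
        intro j
        rw [coeff_mul]
        refine Ideal.sum_mem _ fun x hx => ?_
        have hxj := Finset.HasAntidiagonal.mem_antidiagonal.1 hx
        have hbx := ih b hb x.2
        -- The constant coefficient of `a` supplies an extra factor in `K`; otherwise `x.2 < j`, and
        -- the bound on `b` alone suffices.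
        rcases Nat.eq_zero_or_pos x.1 with h0 | h0
        · have ha0 : a.coeff x.1 ∈ K := by
            rw [h0]; exact ha
          have hab := Ideal.mul_mem_mul ha0 hbx
          rw [← pow_succ'] at hab
          exact Ideal.pow_le_pow_right (by omega) hab
        · exact Ideal.mul_mem_left _ _ (Ideal.pow_le_pow_right (by omega) hbx)
      | add a _ b _ ha hb =>
        intro j
        rw [coeff_add]
        exact Ideal.add_mem _ (ha j) (hb j)
  · intro hf
    rw [f.as_sum_range_C_mul_X_pow]
    refine Ideal.sum_mem _ fun j _ => ?_
    have hC : K ≤ (K.comap (constantCoeff : A[X] →+* A)).comap C := fun a ha => by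
      simpa using ha
    have hX : (X : A[X]) ∈ K.comap (constantCoeff : A[X] →+* A) := by simp
    have hcj : C (f.coeff j) ∈ (K.comap (constantCoeff : A[X] →+* A)) ^ (m - j) :=
      Ideal.le_comap_pow C (m - j) (Ideal.pow_right_mono hC _ (hf j))
    have hmul := Ideal.mul_mem_mul hcj (Ideal.pow_mem_pow hX j)
    rw [← pow_add] at hmul
    exact Ideal.pow_le_pow_right (by omega) hmul

/-- Multiplying by `X` shifts coefficients by one, and `m - (j + 1) = (m - 1) - j`. -/
theorem mem_comap_constantCoeff_pow_of_X_mul_mem (K : Ideal A) (m : ℕ) (f : A[X])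
    (hf : X * f ∈ (K.comap (constantCoeff : A[X] →+* A)) ^ m) :
    f ∈ (K.comap (constantCoeff : A[X] →+* A)) ^ (m - 1) := by
  rw [mem_comap_constantCoeff_pow_iff] at hf ⊢
  intro j
  have hj := hf (j + 1)
  rw [coeff_X_mul] at hj
  exact Ideal.pow_le_pow_right (by omega) hj

end Polynomial

namespace Ideal

theorem comap_pow_of_ringEquiv {A B : Type*} [CommRing A] [CommRing B] (e : A ≃+* B)
    (I : Ideal B) (m : ℕ) : I.comap e ^ m = (I ^ m).comap e := by
  rw [← map_symm, ← map_symm, Ideal.map_pow]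

/-- By maximality, `a` is a unit modulo `I`, hence modulo every power of `I`. -/
theorem mem_pow_of_mul_mem_pow_of_notMem {A : Type*} [CommRing A] {I : Ideal A}
    [hI : I.IsMaximal] {a b : A} (ha : a ∉ I) {m : ℕ} (hab : a * b ∈ I ^ m) : b ∈ I ^ m := by
  have hcop : IsCoprime (span {a}) (I ^ m) := by
    refine IsCoprime.pow_right ?_
    rw [isCoprime_iff_sup_eq, sup_comm]
    exact hI.out.2 _ (lt_of_le_of_ne le_sup_left fun he =>
      ha (he ▸ mem_sup_right (mem_span_singleton_self a)))
  obtain ⟨c, hc, d, hd, hcd⟩ := isCoprime_iff_exists.1 hcop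
  obtain ⟨e, rfl⟩ := mem_span_singleton'.1 hc
  have hb : b = e * (a * b) + d * b := by linear_combination (-b) * hcd
  rw [hb]
  exact (I ^ m).add_mem (mul_mem_left _ _ hab) (mul_mem_right _ _ hd)

end Ideal

namespace Polynomial

variable {A F : Type*} [CommRing A] [Field F] (φ : A →+* F)

theorem mem_ker_eval₂RingHom_iff (h : A) (f : A[X]) :
    f ∈ RingHom.ker (eval₂RingHom φ (φ h)) ↔ f.eval h ∈ RingHom.ker φ := by
  rw [RingHom.mem_ker, RingHom.mem_ker, coe_eval₂RingHom, eval₂_at_apply]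

/-- The shift `z ↦ z + h` straightens the graph of `h` to `z = 0` and turns `z - h` into `z`, so the
coefficientwise description of powers applies. -/
theorem ker_eval₂RingHom_eq_comap_taylor (h : A) :
    RingHom.ker (eval₂RingHom φ (φ h)) =
      ((RingHom.ker φ).comap (constantCoeff : A[X] →+* A)).comap (taylorEquiv h) := by
  ext f
  rw [mem_ker_eval₂RingHom_iff, Ideal.mem_comap, Ideal.mem_comap, ← taylor_coeff_zero]
  rfl

theorem mem_ker_eval₂RingHom_pow_iff_taylor (h : A) (m : ℕ) (f : A[X]) :
    f ∈ RingHom.ker (eval₂RingHom φ (φ h)) ^ m ↔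
      taylorEquiv h f ∈ ((RingHom.ker φ).comap (constantCoeff : A[X] →+* A)) ^ m := by
  rw [ker_eval₂RingHom_eq_comap_taylor]
  have key := Ideal.comap_pow_of_ringEquiv (taylorEquiv h).toRingEquiv
    ((RingHom.ker φ).comap (constantCoeff : A[X] →+* A)) m
  exact SetLike.ext_iff.1 key f

theorem mem_ker_eval₂RingHom_pow_of_X_sub_C_mul_mem (h : A) (m : ℕ) (f : A[X])
    (hf : (X - C h) * f ∈ RingHom.ker (eval₂RingHom φ (φ h)) ^ m) :
    f ∈ RingHom.ker (eval₂RingHom φ (φ h)) ^ (m - 1) := by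
  rw [mem_ker_eval₂RingHom_pow_iff_taylor] at hf ⊢
  refine mem_comap_constantCoeff_pow_of_X_mul_mem _ _ _ ?_
  have hX : taylorEquiv h (X - C h) = X := by
    change taylor h (X - C h) = X
    simp
  rwa [map_mul, hX] at hf

theorem X_sub_C_mem_ker_eval₂RingHom_iff (γ : F) (h : A) :
    X - C h ∈ RingHom.ker (eval₂RingHom φ γ) ↔ γ = φ h := by
  simp [RingHom.mem_ker, sub_eq_zero]

theorem C_mem_ker_eval₂RingHom_pow (γ : F) {m : ℕ} {a : A} (ha : a ∈ RingHom.ker φ ^ m) :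
    C a ∈ RingHom.ker (eval₂RingHom φ γ) ^ m := by
  have hC : RingHom.ker φ ≤ (RingHom.ker (eval₂RingHom φ γ)).comap C := fun b hb => by
    simpa [RingHom.mem_ker] using hb
  exact Ideal.le_comap_pow C m (Ideal.pow_right_mono hC _ ha)

theorem eval_mem_ker_pow (h : A) {m : ℕ} {f : A[X]}
    (hf : f ∈ RingHom.ker (eval₂RingHom φ (φ h)) ^ m) : f.eval h ∈ RingHom.ker φ ^ m := by
  have hle : RingHom.ker (eval₂RingHom φ (φ h)) ≤ (RingHom.ker φ).comap (evalRingHom h) :=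
    fun b hb => (mem_ker_eval₂RingHom_iff φ h b).1 hb
  exact Ideal.le_comap_pow (evalRingHom h) m (Ideal.pow_right_mono hle _ hf)

theorem X_sub_C_mul_mem_ker_eval₂RingHom_pow_iff (h : A) {m : ℕ} (hm : 0 < m) (f : A[X]) :
    (X - C h) * f ∈ RingHom.ker (eval₂RingHom φ (φ h)) ^ m ↔
      f ∈ RingHom.ker (eval₂RingHom φ (φ h)) ^ (m - 1) := by
  refine ⟨mem_ker_eval₂RingHom_pow_of_X_sub_C_mul_mem φ h m f, fun hf => ?_⟩
  have hmul := Ideal.mul_mem_mul ((X_sub_C_mem_ker_eval₂RingHom_iff φ _ h).2 rfl) hf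
  rwa [← pow_succ', Nat.sub_add_cancel hm] at hmul

theorem X_sub_C_mul_mem_ker_eval₂RingHom_pow_iff_of_ne (hφ : Function.Surjective φ) (h : A)
    {γ : F} (hγ : γ ≠ φ h) (m : ℕ) (f : A[X]) :
    (X - C h) * f ∈ RingHom.ker (eval₂RingHom φ γ) ^ m ↔
      f ∈ RingHom.ker (eval₂RingHom φ γ) ^ m := by
  have hmax : (RingHom.ker (eval₂RingHom φ γ)).IsMaximal :=
    RingHom.ker_isMaximal_of_surjective _ fun c => by
      obtain ⟨a, rfl⟩ := hφ c
      exact ⟨C a, by simp⟩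
  refine ⟨Ideal.mem_pow_of_mul_mem_pow_of_notMem ?_, Ideal.mul_mem_left _ _⟩
  rwa [X_sub_C_mem_ker_eval₂RingHom_iff]

end Polynomial

namespace Hermitian

variable {F : Type*} [Field F] {q : ℕ}

theorem evalAt_surjective (P : RatPoint F q) :
    Function.Surjective (evalAt P : CoordRing F q →+* F) :=
  fun c => ⟨algebraMap F _ c, (evalAt P).commutes c⟩

theorem mem_interpIdeal_iff {n : ℕ} (P : Fin n → RatPoint F q) (M : Fin n → F → ℕ)
    (f : (CoordRing F q)[X]) :
    f ∈ interpIdeal P M ↔ ∀ i γ, f ∈ surfMaxIdeal (P i) γ ^ M i γ :=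
  forall₂_congr fun _ _ => le_ordAlong_iff _ _ _

theorem mem_valIdeal_iff {n : ℕ} (P : Fin n → RatPoint F q) (N : Fin n → ℕ)
    (a : CoordRing F q) : a ∈ valIdeal P N ↔ ∀ i, a ∈ maxIdeal (P i) ^ N i :=
  forall_congr' fun _ => le_ordAlong_iff _ _ _

theorem le_maxMult [Fintype F] {n : ℕ} (M : Fin n → F → ℕ) (i : Fin n) (γ : F) :
    M i γ ≤ maxMult M i :=
  Finset.le_sup' (M i) (Finset.mem_univ γ)

theorem C_mem_interpIdeal [Fintype F] {n : ℕ} {P : Fin n → RatPoint F q} {M : Fin n → F → ℕ}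
    {a : CoordRing F q} (ha : a ∈ valIdeal P (maxMult M)) : C a ∈ interpIdeal P M := by
  rw [mem_valIdeal_iff] at ha
  rw [mem_interpIdeal_iff]
  exact fun i γ => Ideal.pow_le_pow_right (le_maxMult M i γ) <| (
    Polynomial.C_mem_ker_eval₂RingHom_pow (evalAt (P i) : CoordRing F q →+* F) γ (ha i))

theorem X_sub_C_mul_mem_interpIdeal_iff [Fintype F] {n : ℕ} {P : Fin n → RatPoint F q}
    {M : Fin n → F → ℕ} {g : Fin n → F}
    (hg : ∀ i, 0 < maxMult M i → M i (g i) = maxMult M i) {h : CoordRing F q}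
    (hh : ∀ i, 0 < maxMult M i → evalAt (P i) h = g i) (f : (CoordRing F q)[X]) :
    (X - C h) * f ∈ interpIdeal P M ↔ f ∈ interpIdeal P (lowered M g) := by
  rw [mem_interpIdeal_iff, mem_interpIdeal_iff]
  refine forall₂_congr fun i γ => ?_
  by_cases hi : 0 < maxMult M i ∧ γ = g i
  · have hlow : lowered M g i γ = M i γ - 1 := if_pos hi
    have hpos : 0 < M i γ := by rw [hi.2, hg i hi.1]; exact hi.1
    obtain rfl : γ = evalAt (P i) h := hi.2.trans (hh i hi.1).symm
    rw [hlow]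
    exact Polynomial.X_sub_C_mul_mem_ker_eval₂RingHom_pow_iff
      (evalAt (P i) : CoordRing F q →+* F) h hpos f
  · have hlow : lowered M g i γ = M i γ := if_neg hi
    rw [hlow]
    by_cases hγ : γ = evalAt (P i) h
    -- On the graph of `h` but not lowered: `n_i > 0` would force `γ = γ_i`, so `n_i = 0` and there
    -- is no condition on either side.
    · have hM : M i γ = 0 := by
        by_contra hne
        have hpos : 0 < maxMult M i := (Nat.pos_of_ne_zero hne).trans_le (le_maxMult M i γ)
        exact hi ⟨hpos, hγ.trans (hh i hpos)⟩
      rw [hM]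
      have hall : ∀ b : (CoordRing F q)[X], b ∈ surfMaxIdeal (P i) γ ^ 0 := fun b =>
        (le_ordAlong_iff _ b 0).1 zero_le
      exact iff_of_true (hall _) (hall _)
    · exact Polynomial.X_sub_C_mul_mem_ker_eval₂RingHom_pow_iff_of_ne
        (evalAt (P i) : CoordRing F q →+* F) (evalAt_surjective (P i)) h hγ _ f

theorem eval_mem_valIdeal [Fintype F] {n : ℕ} {P : Fin n → RatPoint F q} {M : Fin n → F → ℕ}
    {g : Fin n → F} (hg : ∀ i, 0 < maxMult M i → M i (g i) = maxMult M i) {h : CoordRing F q}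
    (hh : ∀ i, 0 < maxMult M i → evalAt (P i) h = g i) {f : (CoordRing F q)[X]}
    (hf : f ∈ interpIdeal P M) : f.eval h ∈ valIdeal P (maxMult M) := by
  rw [mem_interpIdeal_iff] at hf
  rw [mem_valIdeal_iff]
  intro i
  rcases Nat.eq_zero_or_pos (maxMult M i) with h0 | hpos
  · simp [h0]
  have hfi := hf i (g i)
  rw [hg i hpos, ← hh i hpos] at hfi
  exact Polynomial.eval_mem_ker_pow (evalAt (P i) : CoordRing F q →+* F) h hfi

end Hermitian

/-- `P_1, …, P_n` is an enumeration `P` of all rational points of the Hermitian curve.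
The values `g i = γ_i` are constrained, and used, only for `i` with `n_i > 0`. The equality is one
of `R`-submodules of `R[z]`, where `z` is `Polynomial.X`. -/
theorem mainTheorem2 {F : Type*} [Field F] [Fintype F] {q : ℕ} (hq : IsPrimePow q)
    (hF : Fintype.card F = q ^ 2) {n : ℕ} (P : Fin n ≃ Hermitian.RatPoint F q)
    (M : Fin n → F → ℕ) (g : Fin n → F)
    (hg : ∀ i, 0 < Hermitian.maxMult M i → M i (g i) = Hermitian.maxMult M i)
    (h : Hermitian.CoordRing F q)
    (hh : ∀ i, 0 < Hermitian.maxMult M i → Hermitian.evalAt (P i) h = g i) :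
    (Hermitian.interpIdeal P M).restrictScalars (Hermitian.CoordRing F q) =
      ((Hermitian.interpIdeal P (Hermitian.lowered M g)).restrictScalars
          (Hermitian.CoordRing F q)).map
        (LinearMap.mulLeft (Hermitian.CoordRing F q) (Polynomial.X - Polynomial.C h)) +
      Submodule.map
        (Algebra.linearMap (Hermitian.CoordRing F q) (Polynomial (Hermitian.CoordRing F q)))
        (Hermitian.valIdeal P (Hermitian.maxMult M)) := by
  apply le_antisymm
  · intro f hf
    have hf : f ∈ Hermitian.interpIdeal P M := hf
    have hr := Hermitian.eval_mem_valIdeal hg hh hf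
    obtain ⟨f₁, hf₁⟩ := Polynomial.X_sub_C_dvd_sub_C_eval (p := f) (a := h)
    have hmem : (X - C h) * f₁ ∈ Hermitian.interpIdeal P M :=
      hf₁ ▸ Ideal.sub_mem _ hf (Hermitian.C_mem_interpIdeal hr)
    exact Submodule.mem_sup.2 ⟨(X - C h) * f₁,
      ⟨f₁, (Hermitian.X_sub_C_mul_mem_interpIdeal_iff hg hh f₁).1 hmem, rfl⟩,
      C (f.eval h), ⟨f.eval h, hr, rfl⟩, by rw [← hf₁, sub_add_cancel]⟩
  · refine sup_le ?_ ?_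
    · rintro _ ⟨f, hf, rfl⟩
      exact (Hermitian.X_sub_C_mul_mem_interpIdeal_iff hg hh f).2 hf
    · rintro _ ⟨a, ha, rfl⟩
      exact Hermitian.C_mem_interpIdeal ha
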